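/- Let $C\subset\mathbb R^2$ be a convex body (compact, convex, with non-empty interior) that is not a parallelogram. Let $\gamma:[0,1]\to\partial C$ be a parametrization of its boundary as a simple closed curve: $\gamma$ is continuous and onto $\partial C$, injective on $[0,1)$, and $\gamma(0)=\gamma(1)$. For $s\le t$ in $[0,1]$ let $\gamma_{[s,t]}=\gamma([s,t])$, and for $s>t$ let $\gamma_{[s,t]}=\gamma([s,1])\cup\gamma([0,t])$. For $p\in\partial C$ let $g(p)\subset\mathbb S^1$ be the set of unit outer normals of the supporting lines of $C$ at $p$, for $J\subset\partial C$ let $g(J)=\bigcup_{p\in J}g(p)$, and let $|g(J)|$ be the length of $g(J)$ on the unit circle (in radians). Then there are $0\le t_1<t_2<t_3\le 1$ such that $$|g(\gamma_{[t_1,t_2]})|<\pi,\qquad |g(\gamma_{[t_2,t_3]})|<\pi,\qquad |g(\gamma_{[t_3,t_1]})|<\pi .$$ Moreover, for each of these three arcs $J$ and any two vectors $v\ne w$, the translates $v+J$ and $w+J$ have at most one common point, unless their intersection is a non-degenerate closed line segment parallel to $w-v$. (Hence, if $J$ contains no non-degenerate line segment, any two different translates of $J$ meet in at most one point.) -/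

import Mathlib

open Set MeasureTheory
open scoped Pointwise

/-- The Euclidean plane. -/
abbrev Plane : Type := EuclideanSpace ℝ (Fin 2)

/-- `C` is a (nondegenerate) parallelogram: a translate of the set `{a • u + b • v | a, b ∈ [0,1]}`
for linearly independent vectors `u, v`. -/
def IsParallelogram (C : Set Plane) : Prop :=
  ∃ p u v : Plane, LinearIndependent ℝ ![u, v] ∧ C = p +ᵥ parallelepiped ![u, v]

/-- `γ`, restricted to `[0,1]`, is a parametrization of the boundary of `C` as a simple closed
curve: it is continuous, its image is the boundary, and it is injective except that its two ends
agree. -/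
structure IsBoundaryParametrization (C : Set Plane) (γ : ℝ → Plane) : Prop where
  continuousOn : ContinuousOn γ (Icc 0 1)
  injOn : InjOn γ (Ico 0 1)
  closed : γ 0 = γ 1
  image_eq : γ '' Icc 0 1 = frontier C

/-- The arc `γ_[s,t]` of the closed curve `γ : [0,1] → ℝ²` that is traversed from parameter `s` to
parameter `t`; when `t < s` it runs from `s` to `1` and then from `0` to `t`. -/
noncomputable def curveArc (γ : ℝ → Plane) (s t : ℝ) : Set Plane :=
  if s ≤ t then γ '' Icc s t else γ '' Icc s 1 ∪ γ '' Icc 0 t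

/-- The Gauss image of `p` with respect to `C`: the unit outer normals of the supporting lines
of `C` at `p`. -/
def gaussImage (C : Set Plane) (p : Plane) : Set Plane :=
  {n | ‖n‖ = 1 ∧ ∀ x ∈ C, inner ℝ n x ≤ inner ℝ n p}

/-- The Gauss image of a set `J` of boundary points. -/
def gaussImageOf (C : Set Plane) (J : Set Plane) : Set Plane :=
  ⋃ p ∈ J, gaussImage C p

/-- Arc length on the unit circle: the Lebesgue measure of the set of angles in `(-π, π]` of the
points of `S`. -/
noncomputable def circleLength (S : Set Plane) : ENNReal :=
  volume {θ : ℝ | θ ∈ Ioc (-Real.pi) Real.pi ∧ !₂[Real.cos θ, Real.sin θ] ∈ S}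

/-- Any two different translates of `J` have at most one common point, or their intersection is
a nondegenerate segment parallel to the vector that moves one translate to the other. -/
def TranslatesMeetInPointOrParallelSegment (J : Set Plane) : Prop :=
  ∀ v w : Plane, v ≠ w →
    ((v +ᵥ J) ∩ (w +ᵥ J)).Subsingleton ∨
      ∃ x y : Plane, x ≠ y ∧ (v +ᵥ J) ∩ (w +ᵥ J) = segment ℝ x y ∧
        ∃ c : ℝ, y - x = c • (w - v)

/-! Shine parallel light on `C` in a direction `u`. The lit boundary points form a connected graph
of a convex function over the axis perpendicular to `u`. A compact connected subset `J` of this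
graph has both required properties. Every outer normal along `J` has negative inner product with
`u`, by compactness uniformly so, and the normals therefore fill less than a half circle. If two
translates of `J` share two points, then the convex function has two parallel chords of slope `w -
v`, which forces it to be affine between the outermost endpoints.

It remains to find three boundary points such that each pair is lit by a direction that leaves the
third dark: the lit set is connected and misses the third point, so it contains the arc between the
other two. Take points touched by discs inside `C` whose normals `a`, `b`, `c` positively span the
plane; the direction `-(a + b)` lights the first two only. If no such triple existed, the disc
normals would be exactly `±a`, `±b`. Since `C` is the intersection of the half-planes given by its
disc normals, it would be a parallelogram (`exists_posSpan_discNormals`). -/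

/-- The determinant of two plane vectors. -/
def cross (u x : Plane) : ℝ := u 0 * x 1 - u 1 * x 0

/-- The scalar product of two plane vectors in coordinates. -/
def dotp (u x : Plane) : ℝ := u 0 * x 0 + u 1 * x 1

theorem inner_eq_dotp (u x : Plane) : inner ℝ u x = dotp u x := by
  simp [dotp, PiLp.inner_apply, Fin.sum_univ_two, mul_comm]

theorem plane_ext {x y : Plane} (h0 : x 0 = y 0) (h1 : x 1 = y 1) : x = y := by
  ext i; fin_cases i <;> assumption

theorem dotp_self_pos {u : Plane} (hu : u ≠ 0) : 0 < dotp u u := by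
  rw [← inner_eq_dotp]; exact real_inner_self_pos.2 hu

theorem dotp_self_eq_norm_sq (u : Plane) : dotp u u = ‖u‖ ^ 2 := by
  rw [← inner_eq_dotp]; exact real_inner_self_eq_norm_sq u

theorem continuous_cross (u : Plane) : Continuous (cross u) := by
  unfold cross; fun_prop

theorem eq_add_smul_of_cross_eq {u x y : Plane} (hu : u ≠ 0) (h : cross u x = cross u y) :
    x = y + ((dotp u x - dotp u y) / dotp u u) • u := by
  have hd := dotp_self_pos hu
  have hd' : u 0 * u 0 + u 1 * u 1 ≠ 0 := hd.ne'
  simp only [cross] at h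
  apply plane_ext <;> simp only [PiLp.add_apply, PiLp.smul_apply, smul_eq_mul, dotp] <;>
    rw [div_mul_eq_mul_div, ← sub_eq_iff_eq_add', eq_div_iff hd']
  · linear_combination (-u 1) * h
  · linear_combination (u 0) * h

/-! ### The illuminated part of the boundary -/

/-- The part of the boundary of `C` that is illuminated from the direction `u`: moving from such a
point along `u` leads into the interior. -/
def litSet (C : Set Plane) (u : Plane) : Set Plane :=
  {p | p ∈ frontier C ∧ ∃ ε : ℝ, 0 < ε ∧ p + ε • u ∈ interior C}

theorem mem_interior_of_between {C : Set Plane} (hc : Convex ℝ C) {q u : Plane} {s ε : ℝ}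
    (hs : s < 0) (hε : 0 < ε) (hx : q + s • u ∈ C) (hi : q + ε • u ∈ interior C) :
    q ∈ interior C := by
  apply hc.openSegment_self_interior_subset_interior hx hi
  refine ⟨ε / (ε - s), -s / (ε - s), by apply div_pos <;> linarith, by apply div_pos <;> linarith,
    ?_, ?_⟩
  · have : ε - s ≠ 0 := by linarith
    field_simp; ring
  · have : ε - s ≠ 0 := by linarith
    apply plane_ext <;> simp <;> field_simp <;> ring

/-- A point of `C` behind `q` would put `q` strictly between it and an interior point, making `q`
interior. This is the source of both the graph property and the convexity of the lit set. -/
theorem smul_nonneg_of_mem_litSet {C : Set Plane} (hc : Convex ℝ C) {u q : Plane} {s : ℝ}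
    (hq : q ∈ litSet C u) (hx : q + s • u ∈ C) : 0 ≤ s := by
  by_contra! hs
  obtain ⟨hf, ε, hε, hi⟩ := hq
  exact hf.2 (mem_interior_of_between hc hs hε hx hi)

theorem litSet_cross_injOn {C : Set Plane} (hc : Convex ℝ C) (hcl : IsClosed C) {u : Plane}
    (hu : u ≠ 0) : InjOn (cross u) (litSet C u) := by
  intro p hp q hq h
  have h1 := eq_add_smul_of_cross_eq hu h
  have h2 := eq_add_smul_of_cross_eq hu h.symm
  have hpC := hcl.frontier_subset hp.1
  have hqC := hcl.frontier_subset hq.1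
  have h3 := smul_nonneg_of_mem_litSet hc hq (h1 ▸ hpC)
  have h4 := smul_nonneg_of_mem_litSet hc hp (h2 ▸ hqC)
  have h5 : (dotp u p - dotp u q) / dotp u u = 0 := by
    apply le_antisymm _ h3
    rw [← neg_sub, neg_div] at h3 ⊢
    linarith
  rw [h5] at h1
  simpa using h1

theorem IsPreconnected.inter_frontier_nonempty_of_isClosed {X : Type*} [TopologicalSpace X]
    {S C : Set X} (hS : IsPreconnected S) (hC : IsClosed C) (h₁ : (S ∩ interior C).Nonempty)
    (h₂ : (S ∩ Cᶜ).Nonempty) : (S ∩ frontier C).Nonempty := by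
  by_contra hne
  rw [not_nonempty_iff_eq_empty] at hne
  have hcov : S ⊆ interior C ∪ Cᶜ := by
    intro x hx
    by_contra hn
    simp only [mem_union, not_or, mem_compl_iff, not_not] at hn
    exact (hne ▸ (⟨hx, subset_closure hn.2, hn.1⟩ : x ∈ S ∩ frontier C) : x ∈ (∅ : Set X))
  obtain ⟨x, -, hx, hx'⟩ := hS _ _ isOpen_interior hC.isOpen_compl hcov h₁ h₂
  exact hx' (interior_subset hx)

theorem exists_pos_sub_smul_mem_frontier {C : Set Plane} (hk : IsCompact C) {u x : Plane}
    (hu : u ≠ 0) (hx : x ∈ interior C) : ∃ t : ℝ, 0 < t ∧ x - t • u ∈ frontier C := by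
  obtain ⟨D, hD⟩ := hk.isBounded.subset_closedBall x
  have hun : 0 < ‖u‖ := norm_pos_iff.2 hu
  have hcon : IsPreconnected ((fun t : ℝ => x - t • u) '' Ici 0) :=
    isPreconnected_Ici.image _ (by fun_prop)
  have hne : (((fun t : ℝ => x - t • u) '' Ici 0) ∩ frontier C).Nonempty := by
    apply hcon.inter_frontier_nonempty_of_isClosed hk.isClosed
    · exact ⟨x, ⟨0, by simp, by simp⟩, hx⟩
    · refine ⟨_, ⟨(|D| + 1) / ‖u‖, by simp; positivity, rfl⟩, fun h => ?_⟩
      have := hD h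
      rw [Metric.mem_closedBall, dist_eq_norm] at this
      simp [norm_smul] at this
      rw [div_mul_cancel₀ _ hun.ne'] at this
      have h2 : |(|D| + 1)| = |D| + 1 := abs_of_pos (by positivity)
      linarith [le_abs_self D]
  obtain ⟨_, ⟨t, ht, rfl⟩, hf⟩ := hne
  refine ⟨t, lt_of_le_of_ne ht ?_, hf⟩
  rintro rfl
  simp at hf
  exact hf.2 hx

/-- Connectedness is inherited from the interior: pushing an interior point back along `u` until it
reaches the boundary ends at a lit point, and each line parallel to `u` carries at most one. -/
theorem isPreconnected_litSet {C : Set Plane} (hc : Convex ℝ C) (hk : IsCompact C) {u : Plane}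
    (hu : u ≠ 0) : IsPreconnected (litSet C u) := by
  rw [isPreconnected_closed_iff]
  intro K₁ K₂ h₁ h₂ hcov hn₁ hn₂
  have hun : 0 < ‖u‖ := norm_pos_iff.2 hu
  have hfr : IsCompact (frontier C) := hk.of_isClosed_subset isClosed_frontier
    hk.isClosed.frontier_subset
  obtain ⟨D, hD⟩ := Metric.isBounded_iff.1 hk.isBounded
  have hM : ∀ p ∈ C, ∀ t : ℝ, 0 ≤ t → p + t • u ∈ C → t ∈ Icc 0 (D / ‖u‖) := by
    intro p hp t ht h
    refine ⟨ht, ?_⟩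
    have := hD h hp
    rw [dist_eq_norm] at this
    simp [norm_smul, abs_of_nonneg ht] at this
    rwa [le_div_iff₀ hun]
  -- `F K` is the forward sweep of `K ∩ frontier C` along `u`. The sweep time is bounded by the
  -- diameter bound `D`, so `F K` is compact, hence closed.
  let F : Set Plane → Set Plane := fun K =>
    (K ∩ frontier C) + ((fun t : ℝ => t • u) '' Icc 0 (D / ‖u‖))
  have hF : ∀ K, IsClosed K → IsClosed (F K) := fun K hK =>
    ((hfr.inter_left hK).add (isCompact_Icc.image (by fun_prop))).isClosed
  have hlit : ∀ x ∈ interior C, ∀ t : ℝ, 0 ≤ t → ∀ p ∈ frontier C, p + t • u = x →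
      p ∈ litSet C u := by
    rintro x hx t ht p hp rfl
    refine ⟨hp, t, lt_of_le_of_ne ht ?_, hx⟩
    rintro rfl
    simp at hx
    exact hp.2 hx
  have key := isPreconnected_closed_iff.1 hc.interior.isPreconnected (F K₁) (F K₂) (hF _ h₁)
    (hF _ h₂) ?_ ?_ ?_
  · obtain ⟨x, hx, ⟨p, hp, _, ⟨t, ht, rfl⟩, rfl⟩, ⟨q, hq, _, ⟨s, hs, rfl⟩, hqx⟩⟩ := key
    have hpl := hlit _ hx t ht.1 p hp.2 rfl
    have hql := hlit _ hx s hs.1 q hq.2 hqx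
    have : p = q := by
      apply litSet_cross_injOn hc hk.isClosed hu hpl hql
      have h := congrArg (cross u) hqx
      simp [cross] at h ⊢
      linarith
    subst this
    exact ⟨p, hpl, hp.1, hq.1⟩
  · intro x hx
    obtain ⟨t, ht, hf⟩ := exists_pos_sub_smul_mem_frontier hk hu hx
    have htM := hM _ (hk.isClosed.frontier_subset hf) t ht.le (by simpa using interior_subset hx)
    rcases hcov (hlit x hx t ht.le _ hf (by simp)) with h | h
    · exact Or.inl ⟨_, ⟨h, hf⟩, _, ⟨t, htM, rfl⟩, by simp⟩
    · exact Or.inr ⟨_, ⟨h, hf⟩, _, ⟨t, htM, rfl⟩, by simp⟩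
  · obtain ⟨p, ⟨hp, ε, hε, hi⟩, hpK⟩ := hn₁
    exact ⟨_, hi, p, ⟨hpK, hp⟩, _, ⟨ε, hM p (hk.isClosed.frontier_subset hp) ε hε.le
      (interior_subset hi), rfl⟩, rfl⟩
  · obtain ⟨p, ⟨hp, ε, hε, hi⟩, hpK⟩ := hn₂
    exact ⟨_, hi, p, ⟨hpK, hp⟩, _, ⟨ε, hM p (hk.isClosed.frontier_subset hp) ε hε.le
      (interior_subset hi), rfl⟩, rfl⟩

/-! ### Convexity of the lit graph and intersections of translates -/

/-- The height of `x` in the direction `u` above the line of slope `k` over the `cross u`-axis. -/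
def tilt (u : Plane) (k : ℝ) (x : Plane) : ℝ := dotp u x - k * cross u x

theorem eq_of_cross_eq_of_tilt_eq {u x y : Plane} {k : ℝ} (hu : u ≠ 0)
    (h : cross u x = cross u y) (ht : tilt u k x = tilt u k y) : x = y := by
  have h1 := eq_add_smul_of_cross_eq hu h
  have h2 : dotp u x - dotp u y = 0 := by
    simp only [tilt, h] at ht
    linarith
  rw [h2] at h1
  simpa using h1

theorem tilt_convex_on_litSet {C : Set Plane} (hc : Convex ℝ C) (hcl : IsClosed C) {u : Plane}
    (hu : u ≠ 0) (k : ℝ) {p q r : Plane} (hp : p ∈ litSet C u) (hq : q ∈ litSet C u)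
    (hr : r ∈ litSet C u) (hpq : cross u p ≤ cross u q) (hqr : cross u q ≤ cross u r)
    (hpr : cross u p < cross u r) :
    tilt u k q * (cross u r - cross u p) ≤
      tilt u k p * (cross u r - cross u q) + tilt u k r * (cross u q - cross u p) := by
  have hD : 0 < cross u r - cross u p := by linarith
  have hD' := hD.ne'
  set α := (cross u r - cross u q) / (cross u r - cross u p) with hα
  set β := (cross u q - cross u p) / (cross u r - cross u p) with hβ
  have hα0 : 0 ≤ α := div_nonneg (by linarith) hD.le
  have hβ0 : 0 ≤ β := div_nonneg (by linarith) hD.le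
  have hab : α + β = 1 := by rw [hα, hβ]; field_simp; ring
  have hx : α • p + β • r ∈ C :=
    hc (hcl.frontier_subset hp.1) (hcl.frontier_subset hr.1) hα0 hβ0 hab
  have hcx : cross u (α • p + β • r) = α * cross u p + β * cross u r := by
    simp [cross]; ring
  have hdx : dotp u (α • p + β • r) = α * dotp u p + β * dotp u r := by
    simp [dotp]; ring
  have hcq : α * cross u p + β * cross u r = cross u q := by
    rw [hα, hβ]; field_simp; ring
  have heq := eq_add_smul_of_cross_eq hu (hcx.trans hcq)
  have hs := smul_nonneg_of_mem_litSet hc hq (heq ▸ hx)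
  have hd := dotp_self_pos hu
  rw [le_div_iff₀ hd, zero_mul, sub_nonneg, hdx] at hs
  have h1 : α * (cross u r - cross u p) = cross u r - cross u q := by rw [hα]; field_simp
  have h2 : β * (cross u r - cross u p) = cross u q - cross u p := by rw [hβ]; field_simp
  have h3 := mul_le_mul_of_nonneg_right hs hD.le
  rw [← h1, ← h2]
  have h4 : tilt u k q = dotp u q - k * (α * cross u p + β * cross u r) := by rw [hcq, tilt]
  rw [h4, tilt, tilt]
  nlinarith

/-- With `l` leftmost and `r` rightmost, convexity at `l'` gives height of `l` ≤ height of `r`, and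
convexity at `r'` gives the reverse. A convex function that takes its common end value at an inner
point too is constant. The order of `l'` and `r'` is irrelevant. -/
theorem tilt_eq_of_two_chords {C : Set Plane} (hc : Convex ℝ C) (hcl : IsClosed C) {u : Plane}
    (hu : u ≠ 0) {k : ℝ} {l l' r' r z : Plane} (hl : l ∈ litSet C u) (hl' : l' ∈ litSet C u)
    (hr' : r' ∈ litSet C u) (hr : r ∈ litSet C u) (hz : z ∈ litSet C u)
    (hll' : cross u l < cross u l') (hl'r : cross u l' < cross u r)
    (hlr' : cross u l < cross u r') (hr'r : cross u r' < cross u r)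
    (htl : tilt u k l' = tilt u k l) (htr : tilt u k r' = tilt u k r)
    (hlz : cross u l ≤ cross u z) (hzr : cross u z ≤ cross u r) :
    tilt u k z = tilt u k l ∧ tilt u k r = tilt u k l := by
  have h1 := tilt_convex_on_litSet hc hcl hu k hl hl' hr hll'.le hl'r.le (hll'.trans hl'r)
  have h2 := tilt_convex_on_litSet hc hcl hu k hl hr' hr hlr'.le hr'r.le (hlr'.trans hr'r)
  have e : tilt u k r = tilt u k l := by
    rw [htl] at h1
    rw [htr] at h2
    apply le_antisymm
    · nlinarith
    · nlinarith
  refine ⟨?_, e⟩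
  apply le_antisymm
  · have h3 := tilt_convex_on_litSet hc hcl hu k hl hz hr hlz hzr (hll'.trans hl'r)
    rw [e] at h3
    nlinarith
  · rcases le_total (cross u z) (cross u l') with h | h
    · have h3 := tilt_convex_on_litSet hc hcl hu k hz hl' hr h hl'r.le (by linarith)
      rw [e, htl] at h3
      nlinarith
    · have h3 := tilt_convex_on_litSet hc hcl hu k hl hl' hz hll'.le h (by linarith)
      rw [htl] at h3
      nlinarith

theorem cross_sub (u x y : Plane) : cross u (x - y) = cross u x - cross u y := by
  simp [cross]; ring

theorem dotp_sub (u x y : Plane) : dotp u (x - y) = dotp u x - dotp u y := by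
  simp [dotp]; ring

theorem tilt_sub (u : Plane) (k : ℝ) (x y : Plane) :
    tilt u k (x - y) = tilt u k x - tilt u k y := by
  simp only [tilt, cross_sub, dotp_sub]; ring

theorem tilt_eq_zero {u d : Plane} (hd : cross u d ≠ 0) : tilt u (dotp u d / cross u d) d = 0 := by
  rw [tilt]; field_simp; ring

/-- Each common point `x` of the translates yields a chord of `J` from `x - v` to `x - w`,
horizontal after tilting by the slope of `w - v`. Two common points give the two chords; the sign of
`cross u v - cross u w` decides which ends are outermost. -/
theorem tilt_sub_eq_on_translates {C : Set Plane} (hc : Convex ℝ C) (hcl : IsClosed C) {u : Plane}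
    (hu : u ≠ 0) {J : Set Plane} (hJ : J ⊆ litSet C u) {v w x y z : Plane} {k : ℝ}
    (hxv : x - v ∈ J) (hxw : x - w ∈ J) (hyv : y - v ∈ J) (hyw : y - w ∈ J) (hz : z ∈ J)
    (hxy : cross u x < cross u y) (hvw : cross u v ≠ cross u w) (hk : tilt u k v = tilt u k w)
    (hzx : min (cross u (x - v)) (cross u (x - w)) ≤ cross u z)
    (hzy : cross u z ≤ max (cross u (y - v)) (cross u (y - w))) :
    tilt u k z = tilt u k (x - v) ∧ tilt u k (y - v) = tilt u k (x - v) := by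
  simp only [cross_sub, tilt_sub] at *
  rcases lt_or_gt_of_ne hvw with h | h
  · have := tilt_eq_of_two_chords hc hcl hu (k := k) (hJ hxw) (hJ hxv) (hJ hyw) (hJ hyv) (hJ hz)
    simp only [cross_sub, tilt_sub] at this
    rw [min_eq_right (by linarith)] at hzx
    rw [max_eq_left (by linarith)] at hzy
    have := this (by linarith) (by linarith) (by linarith) (by linarith) (by linarith)
      (by linarith) hzx hzy
    constructor <;> linarith [this.1, this.2]
  · have := tilt_eq_of_two_chords hc hcl hu (k := k) (hJ hxv) (hJ hxw) (hJ hyv) (hJ hyw) (hJ hz)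
    simp only [cross_sub, tilt_sub] at this
    rw [min_eq_left (by linarith)] at hzx
    rw [max_eq_right (by linarith)] at hzy
    have := this (by linarith) (by linarith) (by linarith) (by linarith) (by linarith)
      (by linarith) hzx hzy
    constructor <;> linarith [this.1, this.2]

theorem translatesMeet_of_subset_litSet {C : Set Plane} (hc : Convex ℝ C) (hcl : IsClosed C)
    {u : Plane} (hu : u ≠ 0) {J : Set Plane} (hJ : J ⊆ litSet C u) (hk : IsCompact J)
    (hpc : IsPreconnected J) : TranslatesMeetInPointOrParallelSegment J := by
  intro v w hvw
  by_cases hsub : ((v +ᵥ J) ∩ (w +ᵥ J)).Subsingleton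
  · exact Or.inl hsub
  right
  have hmem : ∀ x, x ∈ (v +ᵥ J) ∩ (w +ᵥ J) ↔ x - v ∈ J ∧ x - w ∈ J := by
    intro x
    simp [mem_vadd_set_iff_neg_vadd_mem, sub_eq_neg_add]
  have hinj : ∀ x y v, x - v ∈ J → y - v ∈ J → cross u x = cross u y → x = y := by
    intro x y v hx hy h
    have := litSet_cross_injOn hc hcl hu (hJ hx) (hJ hy) (by rw [cross_sub, cross_sub, h])
    simpa using this
  have hXc : IsCompact ((v +ᵥ J) ∩ (w +ᵥ J)) := (hk.vadd v).inter (hk.vadd w)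
  rw [not_subsingleton_iff] at hsub
  -- The extreme common points in the direction across the light will be the ends of the segment.
  obtain ⟨x, hx, hxmin⟩ := hXc.exists_isMinOn hsub.nonempty (continuous_cross u).continuousOn
  obtain ⟨y, hy, hymax⟩ := hXc.exists_isMaxOn hsub.nonempty (continuous_cross u).continuousOn
  have hxy : cross u x < cross u y := by
    obtain ⟨a, ha, b, hb, hab⟩ := hsub
    have h1 := hxmin ha
    have h2 := hxmin hb
    have h3 := hymax ha
    have h4 := hymax hb
    simp only [mem_ofPred_eq] at h1 h2 h3 h4
    by_contra! hle
    exact hab (hinj a b v ((hmem a).1 ha).1 ((hmem b).1 hb).1 (by linarith))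
  obtain ⟨hxv, hxw⟩ := (hmem x).1 hx
  obtain ⟨hyv, hyw⟩ := (hmem y).1 hy
  have hcvw : cross u v ≠ cross u w := by
    intro h
    apply hvw
    have := litSet_cross_injOn hc hcl hu (hJ hxv) (hJ hxw) (by rw [cross_sub, cross_sub, h])
    simpa using this
  have hcd : cross u (w - v) ≠ 0 := by
    rw [cross_sub, sub_ne_zero]; exact hcvw.symm
  set k := dotp u (w - v) / cross u (w - v) with hkdef
  have htd : tilt u k (w - v) = 0 := tilt_eq_zero hcd
  have htvw : tilt u k v = tilt u k w := by
    rw [tilt_sub] at htd; linarith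
  have key := fun z hz => tilt_sub_eq_on_translates hc hcl hu hJ (z := z) hxv hxw hyv hyw hz hxy
    hcvw htvw
  have htxy : tilt u k y = tilt u k x := by
    have := (key _ hxv (min_le_left _ _) (by
      simp only [cross_sub, le_max_iff]; left; linarith)).2
    simp only [tilt_sub] at this
    linarith
  have hseg : segment ℝ x y ⊆ (v +ᵥ J) ∩ (w +ᵥ J) := by
    rintro z ⟨a, b, ha, hb, hab, rfl⟩
    have hcz : cross u (a • x + b • y) = cross u x + b * (cross u y - cross u x) := by
      obtain rfl : a = 1 - b := by linarith
      simp [cross]; ring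
    have htz : tilt u k (a • x + b • y) = tilt u k x := by
      have : tilt u k (a • x + b • y) = a * tilt u k x + b * tilt u k y := by
        simp [tilt, cross, dotp]; ring
      rw [this, htxy, ← add_mul, hab, one_mul]
    have h0 : 0 ≤ b * (cross u y - cross u x) := mul_nonneg hb (by linarith)
    have h1 : b * (cross u y - cross u x) ≤ cross u y - cross u x := by
      apply mul_le_of_le_one_left <;> linarith
    have hmain : ∀ t, (x - t ∈ J ∧ y - t ∈ J) →
        tilt u k t = tilt u k v → (t = v ∨ t = w) → a • x + b • y - t ∈ J := by
      intro t ht htt htvw'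
      -- Connectedness of `J` supplies a point of `J` over the same abscissa; the constant tilted
      -- height identifies it with the point of the segment.
      obtain ⟨q, hq, hqz⟩ := hpc.intermediate_value ht.1 ht.2 (continuous_cross u).continuousOn
        (show cross u (a • x + b • y - t) ∈ Icc _ _ by
          simp only [cross_sub, hcz]; constructor <;> linarith)
      have hk2 := (key q hq (by
        rw [hqz]; rcases htvw' with rfl | rfl
        · exact (min_le_left _ _).trans (by simp only [cross_sub, hcz]; linarith)
        · exact (min_le_right _ _).trans (by simp only [cross_sub, hcz]; linarith)) (by
        rw [hqz]; rcases htvw' with rfl | rfl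
        · exact le_trans (by simp only [cross_sub, hcz]; linarith) (le_max_left _ _)
        · exact le_trans (by simp only [cross_sub, hcz]; linarith) (le_max_right _ _))).1
      have : q = a • x + b • y - t := by
        apply eq_of_cross_eq_of_tilt_eq (k := k) hu hqz
        rw [hk2, tilt_sub, tilt_sub, htz, htt]
      rwa [← this]
    exact (hmem _).2 ⟨hmain v ⟨hxv, hyv⟩ rfl (Or.inl rfl),
      hmain w ⟨hxw, hyw⟩ htvw.symm (Or.inr rfl)⟩
  refine ⟨x, y, by rintro rfl; exact lt_irrefl _ hxy, Subset.antisymm ?_ hseg, ?_⟩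
  · intro z hz
    have h1 : cross u x ≤ cross u z := hxmin hz
    have h2 : cross u z ≤ cross u y := hymax hz
    have hD : 0 < cross u y - cross u x := by linarith
    have hz' : AffineMap.lineMap x y ((cross u z - cross u x) / (cross u y - cross u x)) ∈
        segment ℝ x y := by
      rw [segment_eq_image_lineMap]
      exact mem_image_of_mem _ ⟨div_nonneg (by linarith) hD.le,
        (div_le_one hD).2 (by linarith)⟩
    have : z = AffineMap.lineMap x y ((cross u z - cross u x) / (cross u y - cross u x)) := by
      apply hinj _ _ v ((hmem z).1 hz).1 ((hmem _).1 (hseg hz')).1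
      have : cross u (AffineMap.lineMap x y ((cross u z - cross u x) / (cross u y - cross u x)))
          = cross u x + (cross u z - cross u x) / (cross u y - cross u x) *
            (cross u y - cross u x) := by
        simp [AffineMap.lineMap_apply, cross]; ring
      rw [this, div_mul_cancel₀ _ hD.ne']; ring
    rw [this]; exact hz'
  · refine ⟨(cross u y - cross u x) / cross u (w - v), ?_⟩
    have hcs : ∀ c : ℝ, cross u (c • (w - v)) = c * cross u (w - v) := by
      intro c; simp [cross]; ring
    have hts : ∀ c : ℝ, tilt u k (c • (w - v)) = c * tilt u k (w - v) := by
      intro c; simp [tilt, dotp, cross]; ring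
    apply eq_of_cross_eq_of_tilt_eq (k := k) hu
    · rw [hcs, div_mul_cancel₀ _ hcd, cross_sub]
    · rw [hts, htd, tilt_sub, htxy]; ring

/-! ### Normals along a lit arc fill less than a half circle -/

theorem inner_lt_zero_of_mem_litSet {C : Set Plane} {u p n : Plane} (hp : p ∈ litSet C u)
    (hn : n ∈ gaussImage C p) : inner ℝ n u < 0 := by
  obtain ⟨-, ε, hε, hi⟩ := hp
  obtain ⟨δ, hδ, hb⟩ := Metric.mem_nhds_iff.1 (mem_interior_iff_mem_nhds.1 hi)
  -- The point lies `δ / 2` beyond an interior point in the direction `n` and is still in `C`, so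
  -- the supporting inequality becomes strict.
  have h := hn.2 (p + ε • u + (δ / 2) • n) (hb (by
    simp [Metric.mem_ball, dist_eq_norm, norm_smul, hn.1, abs_of_pos hδ]; linarith))
  simp only [inner_add_right, inner_smul_right, real_inner_self_eq_norm_sq, hn.1] at h
  by_contra! h0
  have := mul_nonneg hε.le h0
  linarith

/-- The pairs of a point of `J` and a unit normal there form a compact set, so the negative quantity
`inner ℝ n u` attains its maximum. -/
theorem exists_gaussImage_inner_le {C : Set Plane} {u : Plane} {J : Set Plane}
    (hJ : J ⊆ litSet C u) (hk : IsCompact J) :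
    ∃ η : ℝ, 0 < η ∧ ∀ n ∈ gaussImageOf C J, inner ℝ n u ≤ -η := by
  let K : Set (Plane × Plane) := (J ×ˢ Metric.sphere 0 1) ∩
    {x | ∀ y ∈ C, inner ℝ x.2 y ≤ inner ℝ x.2 x.1}
  have hK : IsCompact K := by
    apply (hk.prod (isCompact_sphere 0 1)).inter_right
    simp only [ofPred_forall]
    exact isClosed_biInter fun y _ => isClosed_le (by fun_prop) (by fun_prop)
  have hmem : ∀ n ∈ gaussImageOf C J, ∃ p ∈ J, n ∈ gaussImage C p ∧ (p, n) ∈ K := by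
    intro n hn
    simp only [gaussImageOf, mem_iUnion] at hn
    obtain ⟨p, hp, hn⟩ := hn
    exact ⟨p, hp, hn, ⟨hp, by simpa using hn.1⟩, hn.2⟩
  rcases K.eq_empty_or_nonempty with h | h
  · refine ⟨1, one_pos, fun n hn => ?_⟩
    obtain ⟨p, -, -, h'⟩ := hmem n hn
    simp [h] at h'
  · obtain ⟨⟨p, n⟩, hpn, hmax⟩ := hK.exists_isMaxOn h
      (f := fun x => inner ℝ x.2 u) (by fun_prop)
    refine ⟨-inner ℝ n u, ?_, fun n' hn' => ?_⟩
    · exact neg_pos.2 (inner_lt_zero_of_mem_litSet (hJ hpn.1.1) ⟨by simpa using hpn.1.2, hpn.2⟩)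
    · obtain ⟨p', -, -, h'⟩ := hmem n' hn'
      simpa using hmax h'

theorem abs_le_arccos {x κ : ℝ} (hx : |x| ≤ Real.pi) (h : κ ≤ Real.cos x) :
    |x| ≤ Real.arccos κ := by
  rw [← Real.arccos_cos (abs_nonneg x) hx, Real.cos_abs]
  exact Real.arccos_le_arccos h

/-- Cut the interval of radius `β` about `ψ` by the `2π`-translates of the fundamental domain `(-π,
π]`; the pieces, moved back, cover the set of angles. -/
theorem volume_angles_near (ψ β : ℝ) :
    volume {θ : ℝ | θ ∈ Ioc (-Real.pi) Real.pi ∧ ∃ m : ℤ, |θ - ψ + m * (2 * Real.pi)| ≤ β} ≤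
      ENNReal.ofReal (2 * β) := by
  have hdom := isAddFundamentalDomain_Ioc Real.two_pi_pos (-Real.pi)
  have hvol : volume (Icc (ψ - β) (ψ + β)) = ENNReal.ofReal (2 * β) := by
    rw [Real.volume_Icc]; congr 1; ring
  rw [← hvol, hdom.measure_eq_tsum (Icc (ψ - β) (ψ + β))]
  refine le_trans (measure_mono ?_) (measure_iUnion_le _)
  rintro θ ⟨hθ, m, hm⟩
  rw [mem_iUnion]
  rw [abs_le] at hm
  refine ⟨⟨(-m) • (2 * Real.pi), AddSubgroup.zsmul_mem_zmultiples _ _⟩, ?_, ?_⟩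
  · rw [mem_vadd_set_iff_neg_vadd_mem]
    simp only [AddSubgroup.vadd_def, vadd_eq_add, mem_Icc, AddSubgroup.coe_neg, zsmul_eq_mul]
    push_cast
    constructor <;> linarith [hm.1, hm.2]
  · rw [show -Real.pi + 2 * Real.pi = Real.pi by ring]; exact hθ

theorem circleLength_lt_pi_of_inner_le {S : Set Plane} {u : Plane} {η : ℝ} (hη : 0 < η)
    (hS : ∀ n ∈ S, inner ℝ n u ≤ -η) : circleLength S < ENNReal.ofReal Real.pi := by
  have hpi := Real.pi_pos
  rcases eq_or_ne u 0 with rfl | hu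
  · have : S = ∅ := by
      rw [eq_empty_iff_forall_notMem]
      intro n hn
      have := hS n hn
      simp at this
      linarith
    simp [circleLength, this, hpi]
  -- This is `-u` as a complex number: normals with angle `θ` satisfy `cos (θ - ψ) ≥ η / ‖u‖`, so
  -- they lie within `β < π / 2` of `ψ`.
  let z : ℂ := ⟨-u 0, -u 1⟩
  have hz : 0 < ‖z‖ := by
    rw [norm_pos_iff]
    intro h
    apply hu
    apply plane_ext
    · simpa [z] using congrArg Complex.re h
    · simpa [z] using congrArg Complex.im h
  set ψ := z.arg
  have h0 : ‖z‖ * Real.cos ψ = -u 0 := Complex.norm_mul_cos_arg z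
  have h1 : ‖z‖ * Real.sin ψ = -u 1 := Complex.norm_mul_sin_arg z
  have hψ : ψ ∈ Ioc (-Real.pi) Real.pi := Complex.arg_mem_Ioc z
  set β := Real.arccos (η / ‖z‖)
  have hβ : β < Real.pi / 2 := by
    rw [Real.arccos_lt_pi_div_two]; positivity
  refine lt_of_le_of_lt (le_trans (measure_mono ?_) (volume_angles_near ψ β)) ?_
  · rintro θ ⟨hθ, hθS⟩
    refine ⟨hθ, ?_⟩
    have h := hS _ hθS
    have hcos : η / ‖z‖ ≤ Real.cos (θ - ψ) := by
      rw [inner_eq_dotp] at h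
      simp [dotp] at h
      rw [div_le_iff₀ hz, Real.cos_sub]
      have : (Real.cos θ * Real.cos ψ + Real.sin θ * Real.sin ψ) * ‖z‖ =
        -(Real.cos θ * u 0 + Real.sin θ * u 1) := by
        linear_combination Real.cos θ * h0 + Real.sin θ * h1
      linarith
    have hm : ∀ m : ℤ, |θ - ψ + m * (2 * Real.pi)| ≤ Real.pi →
        |θ - ψ + m * (2 * Real.pi)| ≤ β := fun m hm =>
      abs_le_arccos hm (by rwa [Real.cos_add_int_mul_two_pi])
    obtain ⟨a, b⟩ := hθ
    obtain ⟨c, d⟩ := hψ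
    rcases le_or_gt (θ - ψ) Real.pi with e | e
    · rcases le_or_gt (-Real.pi) (θ - ψ) with f | f
      · exact ⟨0, hm 0 (by rw [abs_le]; constructor <;> push_cast <;> linarith)⟩
      · exact ⟨1, hm 1 (by rw [abs_le]; constructor <;> push_cast <;> linarith)⟩
    · exact ⟨-1, hm (-1) (by rw [abs_le]; constructor <;> push_cast <;> linarith)⟩
  · exact (ENNReal.ofReal_lt_ofReal_iff hpi).2 (by linarith)

/-! ### Arcs of a simple closed curve -/

theorem isCompact_image_Icc {γ : ℝ → Plane} (hγ : ContinuousOn γ (Icc 0 1)) {s t : ℝ} (hs : 0 ≤ s)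
    (ht : t ≤ 1) : IsCompact (γ '' Icc s t) :=
  isCompact_Icc.image_of_continuousOn (hγ.mono (Icc_subset_Icc hs ht))

theorem eq_or_eq_of_mem_both_arcs {C : Set Plane} {γ : ℝ → Plane}
    (hγ : IsBoundaryParametrization C γ) {s c : ℝ} (hs : 0 ≤ s) (hsc : s < c) (hc : c < 1)
    {p : Plane} (h₁ : p ∈ γ '' Icc s c) (h₂ : p ∈ γ '' Icc 0 s ∪ γ '' Icc c 1) :
    p = γ s ∨ p = γ c := by
  obtain ⟨a, ha, rfl⟩ := h₁
  have haI : a ∈ Ico (0 : ℝ) 1 := ⟨hs.trans ha.1, ha.2.trans_lt hc⟩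
  rcases h₂ with ⟨b, hb, h⟩ | ⟨b, hb, h⟩
  · have := hγ.injOn ⟨hb.1, by linarith [hb.2]⟩ haI h
    subst this
    exact Or.inl (by rw [le_antisymm hb.2 ha.1])
  · rcases hb.2.lt_or_eq with h1 | rfl
    · have := hγ.injOn ⟨by linarith [hb.1], h1⟩ haI h
      subst this
      exact Or.inr (by rw [le_antisymm ha.2 hb.1])
    -- The parameter `1` stands for the same point as `0`, and `a = 0` then forces `s = 0`.
    · rw [← hγ.closed] at h
      have := hγ.injOn ⟨le_rfl, one_pos⟩ haI h
      subst this
      exact Or.inl (by rw [le_antisymm hs ha.1])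

/-- The cut points `γ s` and `γ c` split the curve into two closed arcs that meet only there, so a
connected set avoiding both stays in one arc. -/
theorem not_meets_both_arcs {C : Set Plane} {γ : ℝ → Plane}
    (hγ : IsBoundaryParametrization C γ) {A : Set Plane} (hA : IsPreconnected A)
    (hAC : A ⊆ frontier C) {s c a b : ℝ} (hs : 0 ≤ s) (hsc : s < c) (hc : c < 1)
    (hsA : γ s ∉ A) (hcA : γ c ∉ A) (ha : a ∈ Icc s c) (haA : γ a ∈ A)
    (hb : b ∈ Icc 0 s ∪ Icc c 1) (hbA : γ b ∈ A) : False := by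
  have h := isPreconnected_closed_iff.1 hA (γ '' Icc s c) (γ '' Icc 0 s ∪ γ '' Icc c 1)
    (isCompact_image_Icc hγ.continuousOn hs hc.le).isClosed
    ((isCompact_image_Icc hγ.continuousOn le_rfl (by linarith)).isClosed.union
      (isCompact_image_Icc hγ.continuousOn (by linarith) le_rfl).isClosed) ?_
    ⟨_, haA, mem_image_of_mem _ ha⟩
    ⟨_, hbA, hb.imp (mem_image_of_mem _) (mem_image_of_mem _)⟩
  · obtain ⟨p, hp, hp1, hp2⟩ := h
    rcases eq_or_eq_of_mem_both_arcs hγ hs hsc hc hp1 hp2 with rfl | rfl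
    · exact hsA hp
    · exact hcA hp
  · intro p hp
    have := hAC hp
    rw [← hγ.image_eq] at this
    obtain ⟨t, ht, rfl⟩ := this
    rcases le_total t s with h | h
    · exact Or.inr (Or.inl ⟨t, ⟨ht.1, h⟩, rfl⟩)
    · rcases le_total t c with h' | h'
      · exact Or.inl ⟨t, ⟨h, h'⟩, rfl⟩
      · exact Or.inr (Or.inr ⟨t, ⟨h', ht.2⟩, rfl⟩)

/-- If a point `γ s` of the arc were missing from `A`, then cutting at `γ s` and `γ c` would
separate `γ a` from `γ b` inside `A`. -/
theorem curveArc_subset_of_mem {C : Set Plane} {γ : ℝ → Plane}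
    (hγ : IsBoundaryParametrization C γ) {A : Set Plane} (hA : IsPreconnected A)
    (hAC : A ⊆ frontier C) {a b c : ℝ} (ha : 0 ≤ a) (hab : a < b) (hb : b < 1)
    (hc : c ∈ Ico 0 a ∪ Ioo b 1) (haA : γ a ∈ A) (hbA : γ b ∈ A) (hcA : γ c ∉ A) :
    curveArc γ a b ⊆ A := by
  rw [curveArc, if_pos hab.le]
  rintro _ ⟨s, hs, rfl⟩
  by_contra hsA
  rcases hc with hc | hc
  · exact not_meets_both_arcs hγ hA hAC hc.1 (hc.2.trans_le hs.1) (hs.2.trans_lt hb) hcA hsA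
      ⟨hc.2.le, hs.1⟩ haA (Or.inr ⟨hs.2, hb.le⟩) hbA
  · exact not_meets_both_arcs hγ hA hAC (ha.trans hs.1) (hs.2.trans_lt hc.1) hc.2 hsA hcA
      ⟨hs.2, hc.1.le⟩ hbA (Or.inl ⟨ha, hs.1⟩) haA

theorem curveArc_wrap_subset_of_mem {C : Set Plane} {γ : ℝ → Plane}
    (hγ : IsBoundaryParametrization C γ) {A : Set Plane} (hA : IsPreconnected A)
    (hAC : A ⊆ frontier C) {a b c : ℝ} (ha : 0 ≤ a) (hac : a < c) (hcb : c < b) (hb : b < 1)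
    (haA : γ a ∈ A) (hbA : γ b ∈ A) (hcA : γ c ∉ A) : curveArc γ b a ⊆ A := by
  rw [curveArc, if_neg (by linarith)]
  have h0 : ∀ s ∈ Icc 0 a, γ s ∈ A := by
    intro s hs
    by_contra hsA
    exact not_meets_both_arcs hγ hA hAC hs.1 (hs.2.trans_lt hac) (hcb.trans hb) hsA hcA
      ⟨hs.2, hac.le⟩ haA (Or.inr ⟨hcb.le, hb.le⟩) hbA
  apply union_subset
  · rintro _ ⟨s, hs, rfl⟩
    rcases hs.2.lt_or_eq with h1 | rfl
    · by_contra hsA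
      exact not_meets_both_arcs hγ hA hAC (ha.trans hac.le) (hcb.trans_le hs.1) h1 hcA hsA
        ⟨hcb.le, hs.1⟩ hbA (Or.inl ⟨ha, hac.le⟩) haA
    · rw [← hγ.closed]; exact h0 0 ⟨le_rfl, ha⟩
  · rintro _ ⟨s, hs, rfl⟩
    exact h0 s hs

theorem isCompact_curveArc {C : Set Plane} {γ : ℝ → Plane}
    (hγ : IsBoundaryParametrization C γ) {s t : ℝ} (hs : s ∈ Icc (0 : ℝ) 1)
    (ht : t ∈ Icc (0 : ℝ) 1) : IsCompact (curveArc γ s t) := by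
  rw [curveArc]
  split_ifs
  · exact isCompact_image_Icc hγ.continuousOn hs.1 ht.2
  · exact (isCompact_image_Icc hγ.continuousOn hs.1 le_rfl).union
      (isCompact_image_Icc hγ.continuousOn le_rfl ht.2)

theorem isPreconnected_curveArc {C : Set Plane} {γ : ℝ → Plane}
    (hγ : IsBoundaryParametrization C γ) {s t : ℝ} (hs : s ∈ Icc (0 : ℝ) 1)
    (ht : t ∈ Icc (0 : ℝ) 1) : IsPreconnected (curveArc γ s t) := by
  have h : ∀ {s t : ℝ}, 0 ≤ s → t ≤ 1 → IsPreconnected (γ '' Icc s t) := fun hs ht =>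
    isPreconnected_Icc.image _ (hγ.continuousOn.mono (Icc_subset_Icc hs ht))
  rw [curveArc]
  split_ifs
  · exact h hs.1 ht.2
  · exact (h hs.1 le_rfl).union (γ 1) ⟨1, ⟨hs.2, le_rfl⟩, rfl⟩
      ⟨0, ⟨le_rfl, ht.1⟩, hγ.closed⟩ (h le_rfl ht.2)

/-! ### Boundary points touched by an inscribed disc -/

/-- `n` is the normal of `C` at a boundary point `p` that is touched by a disc inside `C`. -/
structure IsDiscNormal (C : Set Plane) (p n : Plane) : Prop where
  norm_eq_one : ‖n‖ = 1
  mem_frontier : p ∈ frontier C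
  exists_ball : ∃ r : ℝ, 0 < r ∧ Metric.ball (p - r • n) r ⊆ C

namespace IsDiscNormal

variable {C : Set Plane} {p n u : Plane}

theorem mem_litSet (h : IsDiscNormal C p n) (hu : inner ℝ n u < 0) : p ∈ litSet C u := by
  obtain ⟨r, hr, hb⟩ := h.exists_ball
  have hu0 : u ≠ 0 := by rintro rfl; simp at hu
  have huu : 0 < ‖u‖ ^ 2 := by positivity
  -- The ray from `p` along `u` leaves the disc at twice this parameter, so this is the midpoint of
  -- its chord.
  refine ⟨h.mem_frontier, r * (-inner ℝ n u) / ‖u‖ ^ 2, by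
    apply div_pos _ huu; nlinarith, interior_maximal hb Metric.isOpen_ball ?_⟩
  set ε := r * (-inner ℝ n u) / ‖u‖ ^ 2 with hε
  have hε1 : ε * ‖u‖ ^ 2 = r * (-inner ℝ n u) := by rw [hε]; field_simp
  have hε0 : 0 < ε := by rw [hε]; apply div_pos _ huu; nlinarith
  rw [Metric.mem_ball, dist_eq_norm, show p + ε • u - (p - r • n) = ε • u + r • n by abel]
  apply lt_of_pow_lt_pow_left₀ 2 hr.le
  rw [norm_add_sq_real, norm_smul, norm_smul, h.norm_eq_one, inner_smul_left, inner_smul_right,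
    real_inner_comm]
  simp only [Real.norm_eq_abs, mul_pow, sq_abs, conj_trivial]
  have h1 : ε ^ 2 * ‖u‖ ^ 2 = ε * (r * (-inner ℝ n u)) := by rw [← hε1]; ring
  rw [h1]
  have := mul_pos hε0 (mul_pos hr (neg_pos.2 hu))
  nlinarith

/-- If `y` violated this, the direction `p - y` would light `p`, with the point `y` of `C` behind
it. -/
theorem inner_sub_nonpos (h : IsDiscNormal C p n) (hc : Convex ℝ C) {y : Plane} (hy : y ∈ C) :
    inner ℝ n (y - p) ≤ 0 := by
  by_contra! hpos
  have hl : p ∈ litSet C (p - y) := h.mem_litSet (by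
    rw [← neg_sub, inner_neg_right]; linarith)
  have := smul_nonneg_of_mem_litSet hc hl (s := -1) (by simpa using hy)
  linarith

theorem mem_gaussImage (h : IsDiscNormal C p n) (hc : Convex ℝ C) : n ∈ gaussImage C p :=
  ⟨h.norm_eq_one, fun y hy => by
    have := h.inner_sub_nonpos hc hy
    rw [inner_sub_right] at this
    linarith⟩

theorem notMem_litSet (h : IsDiscNormal C p n) (hc : Convex ℝ C) (hu : 0 ≤ inner ℝ n u) :
    p ∉ litSet C u := fun hl =>
  (inner_lt_zero_of_mem_litSet hl (h.mem_gaussImage hc)).not_ge hu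

end IsDiscNormal

/-- The nearest point to `x` outside the interior is touched by the disc about `x`. -/
theorem exists_isDiscNormal_near {C : Set Plane} (hcl : IsClosed C) {x z : Plane}
    (hx : x ∈ interior C) (hz : z ∉ interior C) :
    ∃ p n, IsDiscNormal C p n ∧ dist x p ≤ dist x z := by
  have hcl' : IsClosed (interior C)ᶜ := isOpen_interior.isClosed_compl
  obtain ⟨p, hp, hd⟩ := hcl'.exists_infDist_eq_dist ⟨z, hz⟩ x
  have hr : 0 < dist x p := dist_pos.2 (by rintro rfl; exact hp hx)
  have hb : Metric.ball x (dist x p) ⊆ interior C := by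
    rw [← hd]
    simpa using Metric.ball_infDist_compl_subset (x := x) (s := interior C)
  have hpC : p ∈ C := by
    have h1 : Metric.closedBall x (dist x p) ⊆ C := by
      rw [← closure_ball x hr.ne']
      exact closure_minimal (hb.trans interior_subset) hcl
    exact h1 (by simp [dist_comm])
  have hr' : ‖p - x‖ = dist x p := by rw [dist_comm, dist_eq_norm]
  refine ⟨p, (dist x p)⁻¹ • (p - x), ⟨?_, ⟨subset_closure hpC, hp⟩, dist x p, hr, ?_⟩, ?_⟩
  · rw [norm_smul, hr', Real.norm_eq_abs, abs_of_pos (inv_pos.2 hr), inv_mul_cancel₀ hr.ne']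
  · rw [smul_smul, mul_inv_cancel₀ hr.ne', one_smul, sub_sub_cancel]
    exact hb.trans interior_subset
  · rw [← hd]
    exact Metric.infDist_le_dist_of_mem hz

/-- Disc normals alone cut out `C`: a segment from an interior point `o` to an outside point `y`
crosses the boundary at `z`, and the tangent line at a disc point close enough to `z` separates `y`
from `C`. -/
theorem mem_of_forall_isDiscNormal {C : Set Plane} (hc : Convex ℝ C) (hcl : IsClosed C)
    (hint : (interior C).Nonempty) {y : Plane}
    (hy : ∀ p n, IsDiscNormal C p n → inner ℝ n (y - p) ≤ 0) : y ∈ C := by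
  by_contra hyC
  obtain ⟨o, ho⟩ := hint
  obtain ⟨δ, hδ, hb⟩ := Metric.mem_nhds_iff.1 (mem_interior_iff_mem_nhds.1 ho)
  obtain ⟨z, hzs, hzf⟩ := (convex_segment o y).isPreconnected.inter_frontier_nonempty_of_isClosed
    hcl ⟨o, left_mem_segment ℝ o y, ho⟩ ⟨y, right_mem_segment ℝ o y, hyC⟩
  obtain ⟨c, l, hc0, hl0, hcl1, rfl⟩ := hzs
  set z := c • o + l • y with hz
  have hzC := hcl.frontier_subset hzf
  have hcpos : 0 < c := by
    apply lt_of_le_of_ne hc0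
    rintro rfl
    apply hyC
    obtain rfl : l = 1 := by linarith
    simpa [hz] using hzC
  set a := c * (δ / 2) with ha
  have ha0 : 0 < a := by positivity
  set L := ‖o - z‖ with hL
  have hL0 : 0 ≤ L := norm_nonneg _
  have hden : 0 < a + 2 * L + 1 := by linarith
  -- The disc centre is moved from `z` by `τ * L`, so the touching point is within `2 * τ * L < a`
  -- of `z`. The depth `δ / 2` of `o` behind every tangent line would force a distance of at least
  -- `a`.
  set τ := a / (a + 2 * L + 1) with hτ
  have hτ0 : 0 < τ := div_pos ha0 hden
  have hτ1 : τ < 1 := (div_lt_one hden).2 (by linarith)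
  have hτL : 2 * (τ * L) < a := by
    rw [hτ, div_mul_eq_mul_div, ← mul_div_assoc, div_lt_iff₀ hden]
    nlinarith
  have hx : z + τ • (o - z) ∈ interior C := by
    apply hc.openSegment_self_interior_subset_interior hzC ho
    exact ⟨1 - τ, τ, by linarith, hτ0, by ring, by module⟩
  obtain ⟨p, n, hpn, hd⟩ := exists_isDiscNormal_near hcl hx hzf.2
  have hxz : dist (z + τ • (o - z)) z = τ * L := by
    rw [dist_eq_norm, add_sub_cancel_left, norm_smul, Real.norm_eq_abs, abs_of_pos hτ0]
  have hzp : ‖z - p‖ < a := by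
    rw [← dist_eq_norm]
    have := dist_triangle z (z + τ • (o - z)) p
    rw [dist_comm z (z + τ • (o - z))] at this
    linarith
  have h1 : -‖z - p‖ ≤ inner ℝ n (z - p) := by
    have := abs_real_inner_le_norm n (z - p)
    rw [hpn.norm_eq_one, one_mul] at this
    exact (abs_le.1 this).1
  have h2 : inner ℝ n (z - p) = c * inner ℝ n (o - p) + l * inner ℝ n (y - p) := by
    rw [← inner_smul_right, ← inner_smul_right, ← inner_add_right]
    congr 1
    obtain rfl : l = 1 - c := by linarith
    rw [hz]; module
  have h3 : inner ℝ n (o - p) ≤ -(δ / 2) := by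
    have := hpn.inner_sub_nonpos hc (y := o + (δ / 2) • n) (hb (by
      simp [Metric.mem_ball, dist_eq_norm, norm_smul, hpn.norm_eq_one, abs_of_pos hδ]; linarith))
    rw [add_sub_right_comm, inner_add_right, inner_smul_right, real_inner_self_eq_norm_sq,
      hpn.norm_eq_one] at this
    linarith
  have h4 := mul_le_mul_of_nonneg_left h3 hc0
  have h5 := mul_nonneg hl0 (neg_nonneg.2 (hy p n hpn))
  linarith

/-- Otherwise no tangent half-plane would stop a ray in direction `d`, and `C` would be unbounded.
-/
theorem exists_isDiscNormal_inner_pos {C : Set Plane} (hc : Convex ℝ C) (hk : IsCompact C)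
    (hint : (interior C).Nonempty) {d : Plane} (hd : d ≠ 0) :
    ∃ p n, IsDiscNormal C p n ∧ 0 < inner ℝ n d := by
  by_contra! h
  obtain ⟨o, ho⟩ := hint
  have hall : ∀ s : ℝ, 0 ≤ s → o + s • d ∈ C := by
    intro s hs
    apply mem_of_forall_isDiscNormal hc hk.isClosed ⟨o, ho⟩
    intro p n hpn
    rw [add_sub_right_comm, inner_add_right, inner_smul_right]
    have h1 := hpn.inner_sub_nonpos hc (interior_subset ho)
    have h2 := mul_nonneg hs (neg_nonneg.2 (h p n hpn))
    linarith
  obtain ⟨D, hD⟩ := hk.isBounded.subset_closedBall o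
  have hdn : 0 < ‖d‖ := norm_pos_iff.2 hd
  have := hD (hall ((|D| + 1) / ‖d‖) (by positivity))
  rw [Metric.mem_closedBall, dist_eq_norm, add_sub_cancel_left, norm_smul, Real.norm_eq_abs,
    abs_of_nonneg (by positivity), div_mul_cancel₀ _ hdn.ne'] at this
  linarith [le_abs_self D]

/-! ### Positively spanning normals and parallelograms -/

theorem dotp_mul_cross_sub (a b c : Plane) :
    dotp a b * cross a c - cross a b * dotp a c = dotp a a * cross b c := by
  simp only [dotp, cross]; ring

theorem eq_of_dotp_eq {a b x y : Plane} (h : cross a b ≠ 0) (ha : dotp a x = dotp a y)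
    (hb : dotp b x = dotp b y) : x = y := by
  simp only [dotp, cross] at *
  apply plane_ext
  · apply mul_left_cancel₀ h
    linear_combination b 1 * ha - a 1 * hb
  · apply mul_left_cancel₀ h
    linear_combination a 0 * hb - b 0 * ha

theorem eq_or_eq_neg_of_cross_eq_zero {a c : Plane} (ha1 : dotp a a = 1) (hc1 : dotp c c = 1)
    (h : cross a c = 0) : c = a ∨ c = -a := by
  have ha0 : a ≠ 0 := by
    rintro rfl
    simp [dotp] at ha1
  have h2 : dotp a c ^ 2 = 1 := by
    have : dotp a c ^ 2 + cross a c ^ 2 = dotp a a * dotp c c := by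
      simp only [dotp, cross]; ring
    rw [h, ha1, hc1] at this
    linarith
  rcases mul_self_eq_one_iff.1 ((sq _).symm.trans h2) with h3 | h3
  · left
    apply eq_of_cross_eq_of_tilt_eq (u := a) (k := 0) ha0
    · rw [h]; simp [cross]; ring
    · simp only [tilt, h3, ha1, h]; simp [cross]
  · right
    apply eq_of_cross_eq_of_tilt_eq (u := a) (k := 0) ha0
    · rw [h]; simp [cross]; ring
    · simp only [tilt, h3]
      simp only [dotp] at ha1
      simp [dotp]; linarith

/-- `a`, `b`, `c` positively span the plane, in counterclockwise order. -/
def PosSpan (a b c : Plane) : Prop := 0 < cross a b ∧ 0 < cross b c ∧ 0 < cross c a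

/-- The ratio `dotp a n / cross a n` is the cotangent of the angle from `a` to `n`. Without a
spanning triple, its values right of `a` stay below those left of `a`. A level `t` in between
defines a direction on which only `-a` can be positive. -/
theorem neg_mem_of_no_posSpan {R : Set Plane} (hR1 : ∀ n ∈ R, dotp n n = 1)
    (hR : ∀ d : Plane, d ≠ 0 → ∃ n ∈ R, 0 < dotp n d)
    (hno : ∀ a ∈ R, ∀ b ∈ R, ∀ c ∈ R, ¬ PosSpan a b c) {a : Plane} (ha : a ∈ R) : -a ∈ R := by
  have ha1 := hR1 a ha
  have hrot : ∀ n, dotp n !₂[-a 1, a 0] = cross a n := by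
    intro n; simp [dotp, cross]; ring
  have hrot' : ∀ n, dotp n !₂[a 1, -a 0] = -cross a n := by
    intro n; simp [dotp, cross]; ring
  have hrn : (!₂[-a 1, a 0] : Plane) ≠ 0 := by
    intro h
    have h0 := congrArg (fun v : Plane => v 0) h
    have h1 := congrArg (fun v : Plane => v 1) h
    simp at h0 h1
    simp [dotp, h0, h1] at ha1
  have hrn' : (!₂[a 1, -a 0] : Plane) ≠ 0 := by
    intro h
    have h0 := congrArg (fun v : Plane => v 0) h
    have h1 := congrArg (fun v : Plane => v 1) h
    simp at h0 h1
    simp [dotp, h0, h1] at ha1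
  obtain ⟨b₀, hb₀, hb₀'⟩ := hR _ hrn
  obtain ⟨c₀, hc₀, hc₀'⟩ := hR _ hrn'
  rw [hrot] at hb₀'
  rw [hrot'] at hc₀'
  have hbc : ∀ b ∈ R, ∀ c ∈ R, 0 < cross a b → cross a c < 0 →
      dotp a c / cross a c ≤ dotp a b / cross a b := by
    intro b hb c hc hab hac
    have h1 : cross b c ≤ 0 := by
      by_contra! h
      exact hno a ha b hb c hc ⟨hab, h, by
        have : cross c a = -cross a c := by simp only [cross]; ring
        rw [this]; linarith⟩
    have h2 := dotp_mul_cross_sub a b c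
    rw [ha1, one_mul] at h2
    rw [le_div_iff₀ hab, div_mul_eq_mul_div, div_le_iff_of_neg hac]
    linarith
  let S : Set ℝ := (fun n => dotp a n / cross a n) '' {n | n ∈ R ∧ 0 < cross a n}
  have hSb : BddBelow S := ⟨dotp a c₀ / cross a c₀, by
    rintro _ ⟨b, ⟨hb, hb'⟩, rfl⟩
    exact hbc b hb c₀ hc₀ hb' (by linarith)⟩
  have hSn : S.Nonempty := ⟨_, b₀, ⟨hb₀, hb₀'⟩, rfl⟩
  set t := sInf S
  have htb : ∀ b ∈ R, 0 < cross a b → t ≤ dotp a b / cross a b := fun b hb hab =>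
    csInf_le hSb ⟨b, ⟨hb, hab⟩, rfl⟩
  have htc : ∀ c ∈ R, cross a c < 0 → dotp a c / cross a c ≤ t := fun c hc hac =>
    le_csInf hSn (by
      rintro _ ⟨b, ⟨hb, hb'⟩, rfl⟩
      exact hbc b hb c hc hb' hac)
  have hd : ∀ n, dotp n !₂[-a 0 - t * a 1, -a 1 + t * a 0] = t * cross a n - dotp a n := by
    intro n; simp [dotp, cross]; ring
  -- The vector is `-a` plus `t` times `a` turned by a right angle.
  obtain ⟨n, hn, hn'⟩ := hR !₂[-a 0 - t * a 1, -a 1 + t * a 0] (by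
    intro h
    have h1 := hd a
    rw [h, ha1] at h1
    simp [dotp, cross] at h1
    have : a 0 * a 1 - a 1 * a 0 = 0 := by ring
    rw [this] at h1
    norm_num at h1)
  rw [hd] at hn'
  rcases lt_trichotomy (cross a n) 0 with h | h | h
  · have := htc n hn h
    rw [div_le_iff_of_neg h] at this
    linarith
  · rcases eq_or_eq_neg_of_cross_eq_zero ha1 (hR1 n hn) h with rfl | rfl
    · rw [h, ha1] at hn'
      linarith
    · exact hn
  · have := htb n hn h
    rw [le_div_iff₀ h] at this
    linarith

/-- The vectors `±a`, `±b` bound four open sectors; an element of `R` inside any of them would span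
positively with two of these vectors. -/
theorem exists_pair_of_no_posSpan {R : Set Plane} (hR1 : ∀ n ∈ R, dotp n n = 1)
    (hR : ∀ d : Plane, d ≠ 0 → ∃ n ∈ R, 0 < dotp n d)
    (hno : ∀ a ∈ R, ∀ b ∈ R, ∀ c ∈ R, ¬ PosSpan a b c) :
    ∃ a b, a ∈ R ∧ b ∈ R ∧ -a ∈ R ∧ -b ∈ R ∧ 0 < cross a b ∧
      ∀ c ∈ R, c = a ∨ c = -a ∨ c = b ∨ c = -b := by
  have hneg := fun a => neg_mem_of_no_posSpan hR1 hR hno (a := a)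
  obtain ⟨a, ha, -⟩ := hR !₂[1, 0] (by
    intro h
    have := congrArg (fun v : Plane => v 0) h
    simp at this)
  have ha1 := hR1 a ha
  obtain ⟨b, hb, hab⟩ := hR !₂[-a 1, a 0] (by
    intro h
    have h0 := congrArg (fun v : Plane => v 0) h
    have h1 := congrArg (fun v : Plane => v 1) h
    simp at h0 h1
    simp [dotp, h0, h1] at ha1)
  replace hab : 0 < cross a b := by
    simp [dotp] at hab
    simp only [cross]; linarith
  have hb1 := hR1 b hb
  refine ⟨a, b, ha, hb, hneg a ha, hneg b hb, hab, fun c hc => ?_⟩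
  have hc1 := hR1 c hc
  rcases lt_trichotomy (cross a c) 0 with h1 | h1 | h1
  · rcases lt_trichotomy (cross b c) 0 with h2 | h2 | h2
    · exfalso
      refine hno c hc b hb (-a) (hneg a ha) ⟨?_, ?_, ?_⟩ <;>
        simp only [cross, PiLp.neg_apply] at * <;> linarith
    · have := eq_or_eq_neg_of_cross_eq_zero hb1 hc1 h2
      tauto
    · exfalso
      refine hno c hc a ha b hb ⟨?_, ?_, ?_⟩ <;>
        simp only [cross] at * <;> linarith
  · have := eq_or_eq_neg_of_cross_eq_zero ha1 hc1 h1
    tauto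
  · rcases lt_trichotomy (cross b c) 0 with h2 | h2 | h2
    · exfalso
      refine hno c hc (-a) (hneg a ha) (-b) (hneg b hb) ⟨?_, ?_, ?_⟩ <;>
        simp only [cross, PiLp.neg_apply] at * <;> linarith
    · have := eq_or_eq_neg_of_cross_eq_zero hb1 hc1 h2
      tauto
    · exfalso
      refine hno c hc (-b) (hneg b hb) a ha ⟨?_, ?_, ?_⟩ <;>
        simp only [cross, PiLp.neg_apply] at * <;> linarith

theorem isParallelogram_of_strips {C : Set Plane} {a b : Plane} (hab : 0 < cross a b)
    {A₀ A₁ B₀ B₁ : ℝ} (hA : A₀ < A₁) (hB : B₀ < B₁)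
    (hC : ∀ y, y ∈ C ↔ (A₀ ≤ dotp a y ∧ dotp a y ≤ A₁) ∧ (B₀ ≤ dotp b y ∧ dotp b y ≤ B₁)) :
    IsParallelogram C := by
  have hab' := hab.ne'
  have hA' : A₁ - A₀ ≠ 0 := by linarith
  have hB' : B₁ - B₀ ≠ 0 := by linarith
  -- `e`, `f` is the basis dual to `a`, `b`, so the strips become coordinate intervals.
  set e : Plane := (cross a b)⁻¹ • !₂[b 1, -b 0] with he
  set f : Plane := (cross a b)⁻¹ • !₂[-a 1, a 0] with hf
  have hadd : ∀ n x y : Plane, dotp n (x + y) = dotp n x + dotp n y := by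
    intro n x y; simp [dotp]; ring
  have hsmul : ∀ (n : Plane) (c : ℝ) (x : Plane), dotp n (c • x) = c * dotp n x := by
    intro n c x; simp [dotp]; ring
  have hae : dotp a e = 1 := by
    rw [he, hsmul, inv_mul_eq_one₀ hab']; simp [dotp, cross]; ring
  have hbe : dotp b e = 0 := by
    rw [he, hsmul]; simp [dotp]; right; ring
  have haf : dotp a f = 0 := by
    rw [hf, hsmul]; simp [dotp]; right; ring
  have hbf : dotp b f = 1 := by
    rw [hf, hsmul, inv_mul_eq_one₀ hab']; simp [dotp, cross]; ring
  have hmain : ∀ s t : ℝ, ∀ y : Plane,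
      y = (A₀ • e + B₀ • f) + (s • ((A₁ - A₀) • e) + t • ((B₁ - B₀) • f)) ↔
        dotp a y = A₀ + s * (A₁ - A₀) ∧ dotp b y = B₀ + t * (B₁ - B₀) := by
    intro s t y
    constructor
    · rintro rfl
      simp only [hadd, hsmul, hae, hbe, haf, hbf]
      constructor <;> ring
    · rintro ⟨h1, h2⟩
      apply eq_of_dotp_eq hab'
      · simp only [hadd, hsmul, hae, haf, h1]; ring
      · simp only [hadd, hsmul, hbe, hbf, h2]; ring
  refine ⟨A₀ • e + B₀ • f, (A₁ - A₀) • e, (B₁ - B₀) • f, ?_, ?_⟩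
  · rw [LinearIndependent.pair_iff]
    intro s t h
    have h1 := congrArg (dotp a) h
    have h2 := congrArg (dotp b) h
    simp only [hadd, hsmul, hae, hbe, haf, hbf] at h1 h2
    constructor
    · simpa [dotp, hA'] using h1
    · simpa [dotp, hB'] using h2
  · ext y
    rw [hC, mem_vadd_set]
    constructor
    · rintro ⟨⟨h1, h2⟩, h3, h4⟩
      refine ⟨_, ?_, ((hmain ((dotp a y - A₀) / (A₁ - A₀)) ((dotp b y - B₀) / (B₁ - B₀)) y).2
        ⟨by field_simp; ring, by field_simp; ring⟩).symm⟩
      rw [mem_parallelepiped_iff]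
      refine ⟨![(dotp a y - A₀) / (A₁ - A₀), (dotp b y - B₀) / (B₁ - B₀)], ?_, by simp⟩
      rw [mem_Icc, Pi.le_def, Pi.le_def]
      have ha0 : 0 < A₁ - A₀ := by linarith
      have hb0 : 0 < B₁ - B₀ := by linarith
      constructor
      · intro i
        fin_cases i
        · exact div_nonneg (by linarith) ha0.le
        · exact div_nonneg (by linarith) hb0.le
      · intro i
        fin_cases i
        · exact (div_le_one ha0).2 (by linarith)
        · exact (div_le_one hb0).2 (by linarith)
    · rintro ⟨_, hq, rfl⟩
      rw [mem_parallelepiped_iff] at hq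
      obtain ⟨t, ⟨ht0, ht1⟩, rfl⟩ := hq
      obtain ⟨h1, h2⟩ := (hmain (t 0) (t 1) _).1 rfl
      have : (A₀ • e + B₀ • f) +ᵥ ∑ i, t i • (![(A₁ - A₀) • e, (B₁ - B₀) • f] : Fin 2 → Plane) i =
          (A₀ • e + B₀ • f) + (t 0 • ((A₁ - A₀) • e) + t 1 • ((B₁ - B₀) • f)) := by
        simp [Fin.sum_univ_two]
      rw [this, h1, h2]
      have a0 : 0 ≤ t 0 := ht0 0
      have a1 : 0 ≤ t 1 := ht0 1
      have b0 : t 0 ≤ 1 := ht1 0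
      have b1 : t 1 ≤ 1 := ht1 1
      refine ⟨⟨?_, ?_⟩, ?_, ?_⟩ <;> nlinarith

theorem exists_posSpan_discNormals {C : Set Plane} (hc : Convex ℝ C) (hk : IsCompact C)
    (hint : (interior C).Nonempty) (hpar : ¬ IsParallelogram C) :
    ∃ p q r a b c, IsDiscNormal C p a ∧ IsDiscNormal C q b ∧ IsDiscNormal C r c ∧
      PosSpan a b c := by
  by_contra! hno
  obtain ⟨a, b, ⟨pa, ha⟩, ⟨pb, hb⟩, ⟨pa', ha'⟩, ⟨pb', hb'⟩, hab, hall⟩ :=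
    exists_pair_of_no_posSpan (R := {n | ∃ p, IsDiscNormal C p n})
    (by
      rintro n ⟨p, hn⟩
      rw [dotp_self_eq_norm_sq, hn.norm_eq_one, one_pow])
    (by
      intro d hd
      obtain ⟨p, n, hn, h⟩ := exists_isDiscNormal_inner_pos hc hk hint hd
      exact ⟨n, ⟨p, hn⟩, by rwa [← inner_eq_dotp]⟩)
    (by
      rintro a ⟨p, ha⟩ b ⟨q, hb⟩ c ⟨r, hc⟩
      exact hno p q r a b c ha hb hc)
  -- The strip has positive width because it contains the centre of the disc touching at `p`.
  have hlt : ∀ a p p', IsDiscNormal C p a → IsDiscNormal C p' (-a) →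
      inner ℝ a p' < inner ℝ a p := by
    intro a p p' ha ha'
    obtain ⟨r, hr, hball⟩ := ha.exists_ball
    have h := ha'.inner_sub_nonpos hc (hball (Metric.mem_ball_self hr))
    rw [inner_neg_left, inner_sub_right, inner_sub_right, inner_smul_right,
      real_inner_self_eq_norm_sq, ha.norm_eq_one] at h
    linarith
  apply hpar
  apply isParallelogram_of_strips hab (A₀ := dotp a pa') (A₁ := dotp a pa) (B₀ := dotp b pb')
    (B₁ := dotp b pb)
  · simpa only [inner_eq_dotp] using hlt a pa pa' ha ha'
  · simpa only [inner_eq_dotp] using hlt b pb pb' hb hb'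
  intro y
  simp only [← inner_eq_dotp]
  constructor
  · intro hy
    have h1 := ha.inner_sub_nonpos hc hy
    have h2 := ha'.inner_sub_nonpos hc hy
    have h3 := hb.inner_sub_nonpos hc hy
    have h4 := hb'.inner_sub_nonpos hc hy
    simp only [inner_neg_left, inner_sub_right] at h1 h2 h3 h4
    refine ⟨⟨?_, ?_⟩, ?_, ?_⟩ <;> linarith
  · rintro ⟨⟨h1, h2⟩, h3, h4⟩
    apply mem_of_forall_isDiscNormal hc hk.isClosed hint
    have hsupp : ∀ n p q, IsDiscNormal C p n → IsDiscNormal C q n →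
        inner ℝ n (y - q) ≤ 0 → inner ℝ n (y - p) ≤ 0 := by
      intro n p q hp hq h
      have := hp.inner_sub_nonpos hc (hk.isClosed.frontier_subset hq.mem_frontier)
      rw [inner_sub_right] at *
      linarith
    intro p n hn
    rcases hall n ⟨p, hn⟩ with rfl | rfl | rfl | rfl
    · apply hsupp _ p _ hn ha; rw [inner_sub_right]; linarith
    · apply hsupp _ p _ hn ha'; simp only [inner_sub_right, inner_neg_left]; linarith
    · apply hsupp _ p _ hn hb; rw [inner_sub_right]; linarith
    · apply hsupp _ p _ hn hb'; simp only [inner_sub_right, inner_neg_left]; linarith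

/-! ### Three separated points and the final assembly -/

/-- Some direction illuminates `p` and `q`, but not `r`. -/
def SeparatedByLight (C : Set Plane) (p q r : Plane) : Prop :=
  ∃ u : Plane, u ≠ 0 ∧ p ∈ litSet C u ∧ q ∈ litSet C u ∧ r ∉ litSet C u

theorem SeparatedByLight.symm {C : Set Plane} {p q r : Plane} (h : SeparatedByLight C p q r) :
    SeparatedByLight C q p r := by
  obtain ⟨u, h0, h1, h2, h3⟩ := h
  exact ⟨u, h0, h2, h1, h3⟩

theorem PosSpan.rotate {a b c : Plane} (h : PosSpan a b c) : PosSpan b c a :=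
  ⟨h.2.1, h.2.2, h.1⟩

/-- The direction `-(a + b)` works: `dotp a b > -1` makes it light `p` and `q`, while `c` is a
negative combination of `a` and `b`. -/
theorem separatedByLight_of_posSpan {C : Set Plane} (hc : Convex ℝ C) {p q r a b c : Plane}
    (ha : IsDiscNormal C p a) (hb : IsDiscNormal C q b) (hcn : IsDiscNormal C r c)
    (h : PosSpan a b c) : SeparatedByLight C p q r := by
  obtain ⟨hab, hbc, hca⟩ := h
  have ha1 : dotp a a = 1 := by rw [dotp_self_eq_norm_sq, ha.norm_eq_one, one_pow]
  have hb1 : dotp b b = 1 := by rw [dotp_self_eq_norm_sq, hb.norm_eq_one, one_pow]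
  have hlag : dotp a b ^ 2 + cross a b ^ 2 = dotp a a * dotp b b := by
    simp only [dotp, cross]; ring
  rw [ha1, hb1] at hlag
  have hgt : -1 < dotp a b := by nlinarith [pow_pos hab 2]
  have hdot : ∀ n, dotp n (-(a + b)) = -(dotp n a + dotp n b) := by
    intro n; simp [dotp]; ring
  have hba : dotp b a = dotp a b := by simp only [dotp]; ring
  -- Pair `cross a b • c = -(cross b c) • a - (cross c a) • b` with `a + b`.
  have hc' : cross a b * (dotp c a + dotp c b) = -(cross b c + cross c a) * (1 + dotp a b) := by
    have e1 : cross a b * dotp c a = -(cross b c) * dotp a a - cross c a * dotp a b := by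
      simp only [cross, dotp]; ring
    have e2 : cross a b * dotp c b = -(cross b c) * dotp a b - cross c a * dotp b b := by
      simp only [cross, dotp]; ring
    rw [mul_add, e1, e2, ha1, hb1]; ring
  have hau : inner ℝ a (-(a + b)) < 0 := by
    rw [inner_eq_dotp, hdot, ha1]; linarith
  refine ⟨-(a + b), ?_, ha.mem_litSet hau, hb.mem_litSet ?_, hcn.notMem_litSet hc ?_⟩
  · intro h0
    simp [h0] at hau
  · rw [inner_eq_dotp, hdot, hb1, hba]; linarith
  · rw [inner_eq_dotp, hdot]
    by_contra! hneg
    have h1 : 0 < dotp c a + dotp c b := by linarith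
    have h2 := mul_pos hab h1
    have h3 : 0 < (cross b c + cross c a) * (1 + dotp a b) :=
      mul_pos (by linarith) (by linarith)
    rw [hc'] at h2
    linarith

theorem arc_properties {C : Set Plane} (hc : Convex ℝ C) (hcl : IsClosed C) {u : Plane}
    (hu : u ≠ 0) {J : Set Plane} (hJ : J ⊆ litSet C u) (hk : IsCompact J)
    (hpc : IsPreconnected J) : circleLength (gaussImageOf C J) < ENNReal.ofReal Real.pi ∧
      TranslatesMeetInPointOrParallelSegment J := by
  obtain ⟨η, hη, h⟩ := exists_gaussImage_inner_le hJ hk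
  exact ⟨circleLength_lt_pi_of_inner_le hη h, translatesMeet_of_subset_litSet hc hcl hu hJ hk hpc⟩

theorem exists_sorted_params {γ : ℝ → Plane} (P : Plane → Plane → Plane → Prop)
    (hP : ∀ p q r, P p q r → P q p r ∧ P p r q) {t₁ t₂ t₃ : ℝ} (h₁ : t₁ ∈ Ico (0 : ℝ) 1)
    (h₂ : t₂ ∈ Ico (0 : ℝ) 1) (h₃ : t₃ ∈ Ico (0 : ℝ) 1) (h₁₂ : t₁ ≠ t₂) (h₂₃ : t₂ ≠ t₃)
    (h₁₃ : t₁ ≠ t₃) (h : P (γ t₁) (γ t₂) (γ t₃)) :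
    ∃ s₁ s₂ s₃ : ℝ, 0 ≤ s₁ ∧ s₁ < s₂ ∧ s₂ < s₃ ∧ s₃ < 1 ∧ P (γ s₁) (γ s₂) (γ s₃) := by
  wlog h12 : t₁ < t₂ generalizing t₁ t₂
  · exact this h₂ h₁ h₁₂.symm h₁₃ h₂₃ (hP _ _ _ h).1 (lt_of_le_of_ne (not_lt.1 h12) h₁₂.symm)
  rcases lt_or_gt_of_ne h₂₃ with h23 | h23
  · exact ⟨t₁, t₂, t₃, h₁.1, h12, h23, h₃.2, h⟩
  · rcases lt_or_gt_of_ne h₁₃ with h13 | h13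
    · exact ⟨t₁, t₃, t₂, h₁.1, h13, h23, h₂.2, (hP _ _ _ h).2⟩
    · exact ⟨t₃, t₁, t₂, h₃.1, h13, h12, h₂.2, (hP _ _ _ (hP _ _ _ h).2).1⟩

theorem mainTheorem7 (C : ConvexBody Plane) (hint : (interior (C : Set Plane)).Nonempty)
    (hC : ¬ IsParallelogram (C : Set Plane))
    (γ : ℝ → Plane) (hγ : IsBoundaryParametrization (C : Set Plane) γ) :
    ∃ t₁ t₂ t₃ : ℝ, 0 ≤ t₁ ∧ t₁ < t₂ ∧ t₂ < t₃ ∧ t₃ ≤ 1 ∧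
      (circleLength (gaussImageOf C (curveArc γ t₁ t₂)) < ENNReal.ofReal Real.pi ∧
        circleLength (gaussImageOf C (curveArc γ t₂ t₃)) < ENNReal.ofReal Real.pi ∧
        circleLength (gaussImageOf C (curveArc γ t₃ t₁)) < ENNReal.ofReal Real.pi) ∧
      (TranslatesMeetInPointOrParallelSegment (curveArc γ t₁ t₂) ∧
        TranslatesMeetInPointOrParallelSegment (curveArc γ t₂ t₃) ∧
        TranslatesMeetInPointOrParallelSegment (curveArc γ t₃ t₁)) := by
  have hc := C.convex
  have hk := C.isCompact
  have hcl := hk.isClosed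
  obtain ⟨p, q, r, a, b, c, ha, hb, hcn, habc⟩ := exists_posSpan_discNormals hc hk hint hC
  have hparam : ∀ x ∈ frontier (C : Set Plane), ∃ t ∈ Ico (0 : ℝ) 1, γ t = x := by
    intro x hx
    rw [← hγ.image_eq] at hx
    obtain ⟨t, ht, rfl⟩ := hx
    rcases ht.2.lt_or_eq with h | rfl
    · exact ⟨t, ⟨ht.1, h⟩, rfl⟩
    · exact ⟨0, ⟨le_rfl, one_pos⟩, hγ.closed⟩
  obtain ⟨t₁, h₁, rfl⟩ := hparam p ha.mem_frontier
  obtain ⟨t₂, h₂, rfl⟩ := hparam q hb.mem_frontier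
  obtain ⟨t₃, h₃, rfl⟩ := hparam r hcn.mem_frontier
  have hne : ∀ {s t t' : ℝ}, SeparatedByLight C (γ s) (γ t) (γ t') → s ≠ t' ∧ t ≠ t' := by
    rintro s t t' ⟨u, -, hs, ht, ht'⟩
    exact ⟨by rintro rfl; exact ht' hs, by rintro rfl; exact ht' ht⟩
  have hs₁ := separatedByLight_of_posSpan hc ha hb hcn habc
  have hs₂ := separatedByLight_of_posSpan hc hb hcn ha habc.rotate
  have hs₃ := separatedByLight_of_posSpan hc hcn ha hb habc.rotate.rotate
  -- The three separations together are symmetric in the points, so the order in which the curve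
  -- visits them does not matter.
  obtain ⟨s₁, s₂, s₃, h0, h12, h23, h1, hS₁, hS₂, hS₃⟩ := exists_sorted_params (γ := γ)
    (fun p q r => SeparatedByLight C p q r ∧ SeparatedByLight C q r p ∧ SeparatedByLight C r p q)
    (fun p q r h => ⟨⟨h.1.symm, h.2.2.symm, h.2.1.symm⟩, ⟨h.2.2.symm, h.2.1.symm, h.1.symm⟩⟩)
    h₁ h₂ h₃ (hne hs₂).1.symm (hne hs₁).2 (hne hs₁).1 ⟨hs₁, hs₂, hs₃⟩
  have hI₁ : s₁ ∈ Icc (0 : ℝ) 1 := ⟨h0, by linarith⟩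
  have hI₂ : s₂ ∈ Icc (0 : ℝ) 1 := ⟨by linarith, by linarith⟩
  have hI₃ : s₃ ∈ Icc (0 : ℝ) 1 := ⟨by linarith, h1.le⟩
  have hfr : ∀ u, litSet (C : Set Plane) u ⊆ frontier (C : Set Plane) := fun u x hx => hx.1
  obtain ⟨u₁, hu₁, hp₁, hq₁, hr₁⟩ := hS₁
  obtain ⟨u₂, hu₂, hp₂, hq₂, hr₂⟩ := hS₂
  obtain ⟨u₃, hu₃, hp₃, hq₃, hr₃⟩ := hS₃
  have A₁ := arc_properties hc hcl hu₁ (curveArc_subset_of_mem hγ (isPreconnected_litSet hc hk hu₁)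
    (hfr u₁) h0 h12 (h23.trans h1) (Or.inr ⟨h23, h1⟩) hp₁ hq₁ hr₁)
    (isCompact_curveArc hγ hI₁ hI₂) (isPreconnected_curveArc hγ hI₁ hI₂)
  have A₂ := arc_properties hc hcl hu₂ (curveArc_subset_of_mem hγ (isPreconnected_litSet hc hk hu₂)
    (hfr u₂) hI₂.1 h23 h1 (Or.inl ⟨h0, h12⟩) hp₂ hq₂ hr₂)
    (isCompact_curveArc hγ hI₂ hI₃) (isPreconnected_curveArc hγ hI₂ hI₃)
  have A₃ := arc_properties hc hcl hu₃ (curveArc_wrap_subset_of_mem hγ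
    (isPreconnected_litSet hc hk hu₃) (hfr u₃) h0 h12 h23 h1 hq₃ hp₃ hr₃)
    (isCompact_curveArc hγ hI₃ hI₁) (isPreconnected_curveArc hγ hI₃ hI₁)
  exact ⟨s₁, s₂, s₃, h0, h12, h23, h1.le, ⟨A₁.1, A₂.1, A₃.1⟩, ⟨A₁.2, A₂.2, A₃.2⟩⟩
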